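/- Let $n\ge 1$ and $r\ge 2$ be integers, and let $A$ be an $n\times n$ real matrix with nonnegative entries that is $r$-potent, i.e. $A^r=A$. Call a set $\mathcal S$ of real $n\times n$ matrices decomposable if there are a permutation matrix $P$ and an integer $k$ with $0<k<n$ such that, for every $S\in\mathcal S$, $$P^{-1}SP=\begin{pmatrix} B & C\\ 0 & D\end{pmatrix}$$ with $B$ of size $k\times k$ and $D$ of size $(n-k)\times(n-k)$ (the blocks $B,C,D$ may depend on $S$). Then the multiplicative semigroup $\mathcal S$ generated by $A$ is $\mathcal S=\{A,A^2,\dots,A^{r-1}\}$, and: 1. If $\operatorname{rank}(A)>r-1$, then $\mathcal S$ is decomposable. 2. If $n\ge 2$, $r\ge 3$, $\operatorname{rank}(A)\le r-1$, $A$ is singular, and each of the matrices $A^2,A^3,\dots,A^{r-1}$ has at least one diagonal entry equal to zero, then $\mathcal S$ is decomposable. -/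

import Mathlib

/-- A square matrix is entrywise nonnegative. -/
def Matrix.EntrywiseNonneg {n : ℕ} (A : Matrix (Fin n) (Fin n) ℝ) : Prop :=
  ∀ i j, 0 ≤ A i j

/-- A square matrix `A` is `r`-potent if `A ^ r = A`. -/
def Matrix.IsRPotent {n : ℕ} (A : Matrix (Fin n) (Fin n) ℝ) (r : ℕ) : Prop :=
  A ^ r = A

/-- `M` has the block form `[B C; 0 D]` where `B` is `k × k` and `D` is `(n - k) × (n - k)`. -/
def Matrix.IsBlockUpper {n : ℕ} (k : ℕ) (M : Matrix (Fin n) (Fin n) ℝ) : Prop :=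
  ∀ i j : Fin n, k ≤ (i : ℕ) → (j : ℕ) < k → M i j = 0

/-- A set of `n × n` matrices (in particular a semigroup) is decomposable if there is one
permutation matrix `P` such that all `P⁻¹ A P`, for `A` in the set, have a common block form
`[B C; 0 D]` with `B`, `D` square blocks of positive size. -/
def Matrix.IsDecomposableSet {n : ℕ} (S : Set (Matrix (Fin n) (Fin n) ℝ)) : Prop :=
  ∃ (σ : Equiv.Perm (Fin n)) (k : ℕ), 0 < k ∧ k < n ∧
    ∀ A ∈ S, Matrix.IsBlockUpper k ((σ.permMatrix ℝ)⁻¹ * A * σ.permMatrix ℝ)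

/-!
Put `p = r - 1`. A reducible nonnegative matrix is block triangular after a permutation of the
indices, and so are its powers; thus it suffices to show that an irreducible nonnegative `A` with
`A ^ (p + 1) = A` has rank at most `p` and that `A ^ p` has a positive diagonal. The latter holds
because every index lies on a closed walk.

For the rank, fix an index `i`. Row `i` of `A + A ^ 2 + ⋯ + A ^ p` is a positive left fixed vector
`w` of `A`, so `A` contracts the `ℓ¹` norm with weights `w`. A vector `x` in the range of `A` is
fixed by `A ^ p`, so its norm cannot drop and `|A ^ k x| = A ^ k |x|` for `k ≤ p`. If the `i`-th
coordinates of `A x, …, A ^ p x` all vanish, then `w ⬝ᵥ |x| = ∑ k, (A ^ k |x|) i = 0` and `x = 0`.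
Hence these `p` coordinates embed the range of `A` in a space of dimension `p`.
-/

open scoped Matrix

section Monoid

variable {M : Type*} [Monoid M] {a : M} {p : ℕ}

theorem periodic_pow_succ (h : a ^ (p + 1) = a) : Function.Periodic (fun k => a ^ (k + 1)) p :=
  fun k => by
    change a ^ (k + p + 1) = a ^ (k + 1)
    rw [add_assoc, pow_add, h, pow_succ]

theorem isIdempotentElem_pow_of_pow_succ_eq (hp : 0 < p) (h : a ^ (p + 1) = a) :
    IsIdempotentElem (a ^ p) := by
  obtain ⟨q, rfl⟩ := Nat.exists_eq_add_of_le' hp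
  rw [IsIdempotentElem, ← pow_add, add_right_comm q 1]
  exact periodic_pow_succ h q

theorem mem_closure_singleton_iff_exists_pow_succ {b : M} :
    b ∈ Subsemigroup.closure {a} ↔ ∃ k, b = a ^ (k + 1) := by
  constructor
  · intro hb
    induction hb using Subsemigroup.closure_induction with
    | mem x hx => exact ⟨0, by simpa using hx⟩
    | mul x y _ _ hx hy =>
      obtain ⟨k, rfl⟩ := hx
      obtain ⟨l, rfl⟩ := hy
      exact ⟨k + 1 + l, by rw [← pow_add, ← add_assoc]⟩
  · rintro ⟨k, rfl⟩
    have ha := Subsemigroup.mem_closure_of_mem (Set.mem_singleton a)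
    induction k with
    | zero => simpa using ha
    | succ k ih => exact pow_succ a (k + 1) ▸ mul_mem ih ha

theorem closure_singleton_eq_of_pow_succ_eq (hp : 0 < p) (h : a ^ (p + 1) = a) :
    (Subsemigroup.closure {a} : Set M) = {b | ∃ k, 1 ≤ k ∧ k ≤ p ∧ b = a ^ k} := by
  ext b
  rw [SetLike.mem_coe, mem_closure_singleton_iff_exists_pow_succ]
  constructor
  · rintro ⟨k, rfl⟩
    exact ⟨k % p + 1, by omega, Nat.mod_lt k hp, ((periodic_pow_succ h).map_mod_nat k).symm⟩
  · rintro ⟨k, hk, -, rfl⟩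
    exact ⟨k - 1, by rw [Nat.sub_add_cancel hk]⟩

end Monoid

theorem vecMul_pow_eq {n R : Type*} [Semiring R] [Fintype n] [DecidableEq n] {A : Matrix n n R}
    {w : n → R} (hwA : w ᵥ* A = w) (k : ℕ) : w ᵥ* A ^ k = w := by
  induction k with
  | zero => rw [pow_zero, Matrix.vecMul_one]
  | succ k ih => rw [pow_succ, ← Matrix.vecMul_vecMul, ih, hwA]

section CycleSum

variable {R : Type*} [Ring R] {a : R} {p : ℕ}

/-- The sum `a + a ^ 2 + ⋯ + a ^ p` over one period of the powers of an element `a` with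
`a ^ (p + 1) = a`. It is fixed by multiplication by `a`, so that the rows of the cycle sum of a
matrix are left fixed vectors of that matrix. -/
def cycleSum (a : R) (p : ℕ) : R :=
  ∑ k ∈ Finset.range p, a ^ (k + 1)

theorem cycleSum_mul_self (h : a ^ (p + 1) = a) : cycleSum a p * a = cycleSum a p := by
  have hshift := Finset.sum_range_succ (fun k => a ^ (k + 1)) p
  rw [Finset.sum_range_succ', h, zero_add, pow_one] at hshift
  simpa only [cycleSum, Finset.sum_mul, ← pow_succ] using add_right_cancel hshift

end CycleSum

section Positivity

variable {l m n R : Type*} [Semiring R] [PartialOrder R] [IsStrictOrderedRing R]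

theorem mul_apply_pos [Fintype m] {A : Matrix l m R} {B : Matrix m n R}
    (hA : ∀ i j, 0 ≤ A i j) (hB : ∀ i j, 0 ≤ B i j) {i : l} {j : m} {k : n} (hij : 0 < A i j)
    (hjk : 0 < B j k) : 0 < (A * B) i k :=
  Finset.sum_pos' (fun j _ => mul_nonneg (hA i j) (hB j k))
    ⟨j, Finset.mem_univ j, mul_pos hij hjk⟩

theorem pow_apply_self_pos [Fintype n] [DecidableEq n] {A : Matrix n n R}
    (hA : ∀ i j, 0 ≤ A i j) {i : n} (hi : 0 < A i i) (k : ℕ) : 0 < (A ^ k) i i := by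
  induction k with
  | zero => simp
  | succ k ih => exact pow_succ A k ▸ mul_apply_pos (Matrix.pow_apply_nonneg hA k) hA ih hi

end Positivity

section Reducible

variable {n R : Type*} [Ring R] [LinearOrder R] {A : Matrix n n R}

theorem blockTriangular_mem_of_forall_pos {S : Finset n} (hA : ∀ i j, 0 ≤ A i j)
    (hS : ∀ i ∈ S, ∀ j, 0 < A i j → j ∈ S) : A.BlockTriangular (· ∈ S) := by
  intro i j hji
  obtain ⟨hi, hj⟩ : i ∈ S ∧ j ∉ S := Classical.not_imp.1 hji.not_ge
  by_contra hne
  exact hj (hS i hi j ((hA i j).lt_of_ne' hne))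

theorem exists_blockTriangular_of_not_isIrreducible [Nontrivial n] [Fintype n]
    (hA : ∀ i j, 0 ≤ A i j) (hirr : ¬ A.IsIrreducible) :
    ∃ S : Finset n, S.Nonempty ∧ S ≠ Finset.univ ∧ A.BlockTriangular (· ∈ S) := by
  classical
  let : Quiver n := A.toQuiver
  obtain ⟨i, j, hij⟩ : ∃ i j : n, ∀ q : Quiver.Path i j, ¬ 0 < q.length := by
    by_contra! hpath
    exact hirr ⟨hA, hpath⟩
  let S : Finset n := {k | ∃ q : Quiver.Path i k, 0 < q.length}
  rcases S.eq_empty_or_nonempty with hempty | hne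
  · have hrow : ∀ k, ¬ 0 < A i k := fun k hk => by
      have hkS : k ∈ S := Finset.mem_filter.2
        ⟨Finset.mem_univ k, Quiver.Hom.toPath ⟨hk⟩, Nat.one_pos⟩
      simp [hempty] at hkS
    exact ⟨{i}, Finset.singleton_nonempty i, Finset.singleton_ne_univ i,
      blockTriangular_mem_of_forall_pos hA fun a ha b hab =>
        absurd hab (Finset.mem_singleton.1 ha ▸ hrow b)⟩
  · refine ⟨S, hne, fun huniv => ?_, blockTriangular_mem_of_forall_pos hA fun a ha b hab => ?_⟩
    · obtain ⟨-, q, hq⟩ := Finset.mem_filter.1 (huniv ▸ Finset.mem_univ j)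
      exact hij q hq
    · obtain ⟨-, q, -⟩ := Finset.mem_filter.1 ha
      exact Finset.mem_filter.2 ⟨Finset.mem_univ b, q.cons ⟨hab⟩, q.length.succ_pos⟩

end Reducible

section Nonneg

variable {m n R : Type*} [Ring R] [LinearOrder R] [IsStrictOrderedRing R]

theorem abs_mulVec_le [Fintype n] {A : Matrix m n R} (hA : ∀ i j, 0 ≤ A i j) (x : n → R) :
    |A *ᵥ x| ≤ A *ᵥ |x| := fun i =>
  calc |∑ j, A i j * x j| ≤ ∑ j, |A i j * x j| := Finset.abs_sum_le_sum_abs _ _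
    _ = ∑ j, A i j * |x j| := by simp only [abs_mul, abs_of_nonneg (hA i _)]

theorem eq_of_le_of_dotProduct_le [Fintype n] {w x y : n → R} (hw : ∀ i, 0 < w i) (hxy : x ≤ y)
    (h : w ⬝ᵥ y ≤ w ⬝ᵥ x) : x = y := by
  have hterm : ∀ i ∈ Finset.univ, w i * x i ≤ w i * y i := fun i _ =>
    mul_le_mul_of_nonneg_left (hxy i) (hw i).le
  have hsum := (Finset.sum_eq_sum_iff_of_le hterm).1 ((Finset.sum_le_sum hterm).antisymm h)
  exact funext fun i => mul_left_cancel₀ (hw i).ne' (hsum i (Finset.mem_univ i))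

-- `B` and `C` contract the `ℓ¹` norms with weights `w ᵥ* B` and `w`, hence preserve that of `x`.
theorem abs_mulVec_eq_mulVec_abs [Fintype m] [Fintype n] {B : Matrix m n R} {C : Matrix n m R}
    (hB : ∀ i j, 0 ≤ B i j) (hC : ∀ i j, 0 ≤ C i j) {w : m → R} (hw : ∀ i, 0 < w i)
    (hwBC : w ᵥ* B ᵥ* C = w) {x : n → R} (hx : C *ᵥ B *ᵥ x = x) :
    |B *ᵥ x| = B *ᵥ |x| := by
  have hwB : 0 ≤ w ᵥ* B := fun j => Finset.sum_nonneg fun i _ => mul_nonneg (hw i).le (hB i j)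
  refine eq_of_le_of_dotProduct_le hw (abs_mulVec_le hB x) ?_
  calc w ⬝ᵥ B *ᵥ |x| = w ᵥ* B ⬝ᵥ |C *ᵥ B *ᵥ x| := by rw [hx, Matrix.dotProduct_mulVec]
    _ ≤ w ᵥ* B ⬝ᵥ C *ᵥ |B *ᵥ x| :=
      dotProduct_le_dotProduct_of_nonneg_left (abs_mulVec_le hC _) hwB
    _ = w ⬝ᵥ |B *ᵥ x| := by rw [Matrix.dotProduct_mulVec, hwBC]

variable [Fintype n] [DecidableEq n] {A : Matrix n n R} {p : ℕ}

theorem pow_apply_self_pos_of_isIrreducible (hA : A.IsIrreducible) (hp : 0 < p)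
    (h : A ^ (p + 1) = A) (i : n) : 0 < (A ^ p) i i := by
  obtain ⟨k, hk, hi⟩ := (Matrix.isIrreducible_iff_exists_pow_pos hA.nonneg).1 hA i i
  rw [← (isIdempotentElem_pow_of_pow_succ_eq hp h).pow_eq hk.ne', pow_right_comm]
  exact pow_apply_self_pos (Matrix.pow_apply_nonneg hA.nonneg k) hi p

theorem cycleSum_apply_pos (hA : A.IsIrreducible) (hp : 0 < p) (h : A ^ (p + 1) = A) (i j : n) :
    0 < cycleSum A p i j := by
  obtain ⟨k, hk, hij⟩ := (Matrix.isIrreducible_iff_exists_pow_pos hA.nonneg).1 hA i j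
  obtain ⟨l, rfl⟩ := Nat.exists_eq_add_of_le' hk
  rw [cycleSum, Matrix.sum_apply]
  refine Finset.sum_pos' (fun k _ => Matrix.pow_apply_nonneg hA.nonneg (k + 1) i j)
    ⟨l % p, Finset.mem_range.2 (Nat.mod_lt l hp), ?_⟩
  rwa [(periodic_pow_succ h).map_mod_nat l]

theorem abs_pow_mulVec_eq_pow_mulVec_abs (hA : ∀ i j, 0 ≤ A i j) {w : n → R} (hw : ∀ i, 0 < w i)
    (hwA : w ᵥ* A = w) {x : n → R} (hx : A ^ p *ᵥ x = x) {k : ℕ} (hk : k ≤ p) :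
    |A ^ k *ᵥ x| = A ^ k *ᵥ |x| := by
  refine abs_mulVec_eq_mulVec_abs (C := A ^ (p - k)) (Matrix.pow_apply_nonneg hA k)
    (Matrix.pow_apply_nonneg hA (p - k)) hw ?_ ?_
  · rw [vecMul_pow_eq hwA, vecMul_pow_eq hwA]
  · rw [Matrix.mulVec_mulVec, ← pow_add, Nat.sub_add_cancel hk, hx]

theorem eq_zero_of_forall_pow_mulVec_apply_eq_zero (hA : A.IsIrreducible) (hp : 0 < p)
    (h : A ^ (p + 1) = A) {x : n → R} (hx : A ^ p *ᵥ x = x) {i : n}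
    (hzero : ∀ k < p, (A ^ (k + 1) *ᵥ x) i = 0) : x = 0 := by
  have hpos := cycleSum_apply_pos hA hp h i
  have hfixed : cycleSum A p i ᵥ* A = cycleSum A p i := by
    rw [← Matrix.mul_apply_eq_vecMul, cycleSum_mul_self h]
  have hdot : cycleSum A p i ⬝ᵥ |x| = 0 := by
    change (cycleSum A p *ᵥ |x|) i = 0
    rw [cycleSum, Matrix.sum_mulVec, Finset.sum_apply]
    refine Finset.sum_eq_zero fun k hk => ?_
    have hkp := Finset.mem_range.1 hk
    rw [← abs_pow_mulVec_eq_pow_mulVec_abs hA.nonneg hpos hfixed hx hkp, Pi.abs_apply,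
      hzero k hkp, abs_zero]
  have habs : 0 = |x| := eq_of_le_of_dotProduct_le hpos (fun j => abs_nonneg (x j))
    (by rw [hdot, dotProduct_zero])
  exact funext fun j => abs_eq_zero.1 (congrFun habs j).symm

end Nonneg

theorem rank_le_of_isIrreducible {n R : Type*} [Fintype n] [DecidableEq n] [CommRing R]
    [LinearOrder R] [IsStrictOrderedRing R] {A : Matrix n n R} {p : ℕ} (hA : A.IsIrreducible)
    (hp : 0 < p) (h : A ^ (p + 1) = A) : A.rank ≤ p := by
  rcases isEmpty_or_nonempty n with _ | ⟨⟨i⟩⟩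
  · exact A.rank_le_card_width.trans (by simp)
  let O : Matrix (Fin p) n R := .of fun k => (A ^ (k + 1 : ℕ)) i
  have hinj : Function.Injective (O.mulVecLin.domRestrict (LinearMap.range A.mulVecLin)) := by
    rw [LinearMap.injective_domRestrict_iff, LinearMap.disjoint_ker]
    rintro _ ⟨y, rfl⟩ hy
    refine eq_zero_of_forall_pow_mulVec_apply_eq_zero hA hp h (i := i) ?_
      fun k hk => congrFun hy ⟨k, hk⟩
    rw [Matrix.mulVecLin_apply, Matrix.mulVec_mulVec, ← pow_succ, h]
  simpa [Matrix.rank] using LinearMap.finrank_le_finrank_of_injective hinj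

section Decomposable

theorem permMatrix_inv_mul_mul_permMatrix {n R : Type*} [Fintype n] [DecidableEq n] [CommRing R]
    (σ : Equiv.Perm n) (M : Matrix n n R) :
    (σ.permMatrix R)⁻¹ * M * σ.permMatrix R = M.submatrix σ.symm σ.symm := by
  have hinv : (σ.permMatrix R)⁻¹ = σ⁻¹.permMatrix R :=
    Matrix.inv_eq_left_inv (by rw [← Matrix.permMatrix_mul, mul_inv_cancel, Matrix.permMatrix_one])
  rw [hinv, PEquiv.mul_toMatrix_toPEquiv, PEquiv.toMatrix_toPEquiv_mul]
  rfl

variable {n : ℕ}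

theorem exists_perm_apply_mem_iff (S : Finset (Fin n)) :
    ∃ σ : Equiv.Perm (Fin n), ∀ i, σ i ∈ S ↔ (i : ℕ) < S.card := by
  have hcard : Fintype.card {i : Fin n // (i : ℕ) < S.card} = Fintype.card {i // i ∈ S} := by
    rw [Fintype.card_subtype, Fin.card_filter_val_lt, Fintype.card_coe,
      min_eq_right (card_finset_fin_le S)]
  let e := Fintype.equivOfCardEq hcard
  exact ⟨e.extendSubtype, fun i =>
    ⟨not_imp_not.1 (e.extendSubtype_not_mem i), e.extendSubtype_mem i⟩⟩

theorem isDecomposableSet_of_blockTriangular {S : Finset (Fin n)} (hne : S.Nonempty)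
    (hS : S ≠ Finset.univ) {T : Set (Matrix (Fin n) (Fin n) ℝ)}
    (hT : ∀ M ∈ T, M.BlockTriangular (· ∈ S)) : Matrix.IsDecomposableSet T := by
  obtain ⟨σ, hσ⟩ := exists_perm_apply_mem_iff Sᶜ
  have hpos : 0 < Sᶜ.card := by
    rwa [Finset.card_pos, Finset.nonempty_iff_ne_empty, ne_eq, Finset.compl_eq_empty_iff]
  have hlt : Sᶜ.card < n := by
    simpa using (Finset.card_compl_lt_iff_nonempty S).2 hne
  refine ⟨σ.symm, Sᶜ.card, hpos, hlt, fun M hM i j hi hj => ?_⟩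
  rw [permMatrix_inv_mul_mul_permMatrix]
  have hσi : σ i ∈ S := Finset.notMem_compl.1 ((hσ i).not.2 hi.not_gt)
  have hσj : σ j ∉ S := Finset.mem_compl.1 ((hσ j).2 hj)
  exact hT M hM (lt_of_not_ge fun hle => hσj (hle hσi))

theorem isDecomposableSet_closure_of_not_isIrreducible (hn : 2 ≤ n)
    {A : Matrix (Fin n) (Fin n) ℝ} (hA : A.EntrywiseNonneg) (hirr : ¬ A.IsIrreducible) :
    Matrix.IsDecomposableSet (Subsemigroup.closure {A} : Set (Matrix (Fin n) (Fin n) ℝ)) := by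
  have : Nontrivial (Fin n) := Fin.nontrivial_iff_two_le.2 hn
  obtain ⟨S, hne, hS, hAS⟩ := exists_blockTriangular_of_not_isIrreducible hA hirr
  refine isDecomposableSet_of_blockTriangular hne hS fun M hM => ?_
  obtain ⟨k, rfl⟩ := mem_closure_singleton_iff_exists_pow_succ.1 hM
  exact hAS.pow (k + 1)

end Decomposable

theorem mainTheorem8_general {n : ℕ} (r : ℕ) (hr : 2 ≤ r) (A : Matrix (Fin n) (Fin n) ℝ)
    (hA : A.EntrywiseNonneg) (hAr : A.IsRPotent r) :
    ((Subsemigroup.closure {A} : Subsemigroup (Matrix (Fin n) (Fin n) ℝ)) :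
        Set (Matrix (Fin n) (Fin n) ℝ)) = {B | ∃ k : ℕ, 1 ≤ k ∧ k ≤ r - 1 ∧ B = A ^ k} ∧
    (r - 1 < A.rank →
      Matrix.IsDecomposableSet
        ((Subsemigroup.closure {A} : Subsemigroup (Matrix (Fin n) (Fin n) ℝ)) :
          Set (Matrix (Fin n) (Fin n) ℝ))) ∧
    (2 ≤ n → (∃ i, (A ^ (r - 1)) i i = 0) →
      Matrix.IsDecomposableSet
        ((Subsemigroup.closure {A} : Subsemigroup (Matrix (Fin n) (Fin n) ℝ)) :
          Set (Matrix (Fin n) (Fin n) ℝ))) := by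
  have hp : 0 < r - 1 := by omega
  have hper : A ^ (r - 1 + 1) = A := by rwa [Nat.sub_add_cancel (by omega)]
  refine ⟨closure_singleton_eq_of_pow_succ_eq hp hper, fun hrank => ?_, fun hn ⟨i, hi⟩ => ?_⟩
  · have hn : 2 ≤ n := by
      have := A.rank_le_height
      omega
    exact isDecomposableSet_closure_of_not_isIrreducible hn hA fun hirr =>
      hrank.not_ge (rank_le_of_isIrreducible hirr hp hper)
  · exact isDecomposableSet_closure_of_not_isIrreducible hn hA fun hirr =>
      (pow_apply_self_pos_of_isIrreducible hirr hp hper i).ne' hi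

theorem mainTheorem8 {n : ℕ} (r : ℕ) (hr : 2 ≤ r) (A : Matrix (Fin n) (Fin n) ℝ)
    (hA : A.EntrywiseNonneg) (hAr : A.IsRPotent r) :
    ((Subsemigroup.closure {A} : Subsemigroup (Matrix (Fin n) (Fin n) ℝ)) :
        Set (Matrix (Fin n) (Fin n) ℝ)) = {B | ∃ k : ℕ, 1 ≤ k ∧ k ≤ r - 1 ∧ B = A ^ k} ∧
    (r - 1 < A.rank →
      Matrix.IsDecomposableSet
        ((Subsemigroup.closure {A} : Subsemigroup (Matrix (Fin n) (Fin n) ℝ)) :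
          Set (Matrix (Fin n) (Fin n) ℝ))) ∧
    (2 ≤ n → 3 ≤ r → A.rank ≤ r - 1 → A.det = 0 →
      (∀ k : ℕ, 2 ≤ k → k ≤ r - 1 → ∃ i, (A ^ k) i i = 0) →
      Matrix.IsDecomposableSet
        ((Subsemigroup.closure {A} : Subsemigroup (Matrix (Fin n) (Fin n) ℝ)) :
          Set (Matrix (Fin n) (Fin n) ℝ))) := by
  obtain ⟨hclosure, hrank, hdiag⟩ := mainTheorem8_general r hr A hA hAr
  exact ⟨hclosure, hrank, fun hn hr3 _ _ hzero => hdiag hn (hzero (r - 1) (by omega) le_rfl)⟩
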